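/- Let $m\ge 1$ be an integer. A seller offers $m$ goods to one buyer with additive valuations $x=(x_1,\dots,x_m)\in D=[0,\infty)^m$, where the $x_j$ are independent and $x_j$ is exponentially distributed with parameter $\lambda_j>0$; let $F$ be the law of $x$. A mechanism consists of an allocation function $a:D\to[0,1]^m$ and a payment function $p:D\to[0,\infty)$. It is individually rational if $a(x)\cdot x-p(x)\ge 0$ for all $x\in D$, and incentive compatible if $a(x)\cdot x-p(x)\ge a(x')\cdot x-p(x')$ for all $x,x'\in D$. The optimal revenue $\mathrm{Rev}(F)$ is the supremum of $\mathbb E_{x\sim F}[p(x)]$ over all individually rational and incentive compatible mechanisms. In terms of utility functions, it is the supremum of $\int_D(\nabla u(x)\cdot x-u(x))\,dF(x)$ over all nonnegative convex $u:D\to\mathbb R$ with $0\le\partial u/\partial x_j\le 1$ almost everywhere in $D$ for every $j$. For $w\ge 0$ let $\Gamma(k,w)=\int_w^\infty t^{k-1}e^{-t}\,dt$ and $g(m,w)=\Gamma(m+1,w)-(m+1)\Gamma(m,w)$, and let $G(m)=\int_0^\infty\max\{0,g(m,w)\}\,dw$. Theorem. The function $g(m,\cdot)$ has a unique root $\gamma^*_m$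 in $[0,\infty)$, and $$G(m)=\int_{\gamma^*_m}^\infty g(m,w)\,dw=\gamma^*_m\,\Gamma(m,\gamma^*_m)=(\gamma^*_m)^{m+1}e^{-\gamma^*_m}.$$ With either of the two descriptions of the optimal revenue, $$\mathrm{Rev}(F)\le\frac{G(m)}{m!}\sum_{j=1}^m\frac1{\lambda_j}.$$ In the special case $\lambda_1=\dots=\lambda_m=\lambda$ this bound reads $$\mathrm{Rev}(F)\le\frac{G(m)}{(m-1)!\,\lambda}.$$ -/

import Mathlib

open MeasureTheory ProbabilityTheory

noncomputable section

namespace OptimalSelling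

/-! ### Selling mechanisms for `m` goods and one additive buyer

Functions on the valuation domain `D ⊆ ℝ^m` are represented by functions on `ℝ^m`;
only their values on `D` are constrained. -/

/-- A direct revelation selling mechanism on the valuation domain `D`: good `j` is sold with
probability `alloc x j`, for a total nonnegative payment `pay x`, when the buyer reports `x`. -/
structure Mechanism {m : ℕ} (D : Set (Fin m → ℝ)) where
  alloc : (Fin m → ℝ) → Fin m → ℝ
  pay : (Fin m → ℝ) → ℝ
  alloc_mem : ∀ x ∈ D, ∀ j, alloc x j ∈ Set.Icc (0 : ℝ) 1
  pay_nonneg : ∀ x ∈ D, 0 ≤ pay x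

namespace Mechanism

variable {m : ℕ} {D : Set (Fin m → ℝ)}

/-- The utility of a buyer with true valuations `x` who reports `x'`. -/
def utility (M : Mechanism D) (x' x : Fin m → ℝ) : ℝ :=
  ∑ j, M.alloc x' j * x j - M.pay x'

/-- Individual rationality. -/
def IsIR (M : Mechanism D) : Prop :=
  ∀ x ∈ D, 0 ≤ M.utility x x

/-- Incentive compatibility. -/
def IsIC (M : Mechanism D) : Prop :=
  ∀ x ∈ D, ∀ x' ∈ D, M.utility x' x ≤ M.utility x x

/-- The expected payment when the valuations are drawn from `F`. The payment is nonnegative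
on `D`, so this is an integral with values in `[0, ∞]`. -/
def expectedRevenue (M : Mechanism D) (F : Measure (Fin m → ℝ)) : ENNReal :=
  ∫⁻ x, ENNReal.ofReal (M.pay x) ∂F

end Mechanism

/-- The optimal revenue: the supremum of the expected revenue over all (possibly randomized)
mechanisms on `D` that are individually rational and incentive compatible. -/
def optimalRevenue {m : ℕ} (D : Set (Fin m → ℝ)) (F : Measure (Fin m → ℝ)) : EReal :=
  ⨆ (M : Mechanism D) (_ : M.IsIR ∧ M.IsIC), (M.expectedRevenue F : EReal)

/-! ### The formulation through utility functions -/

/-- The partial derivative of `u` with respect to the `j`-th coordinate. -/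
def partialDeriv {m : ℕ} (u : (Fin m → ℝ) → ℝ) (j : Fin m) (x : Fin m → ℝ) : ℝ :=
  fderiv ℝ u x (Pi.single j 1)

/-- `u` is a nonnegative convex function on `D` whose partial derivatives (which exist) lie
in `[0, 1]` almost everywhere in `D`. -/
structure IsFeasibleUtility {m : ℕ} (D : Set (Fin m → ℝ)) (u : (Fin m → ℝ) → ℝ) : Prop where
  nonneg : ∀ x ∈ D, 0 ≤ u x
  convex : ConvexOn ℝ D u
  partialDeriv_mem : ∀ᵐ x ∂(volume.restrict D),
    DifferentiableAt ℝ u x ∧ ∀ j, partialDeriv u j x ∈ Set.Icc (0 : ℝ) 1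

/-- `R(u; F) = ∫_D (∇u(x) · x - u(x)) dF(x)`. -/
def utilityRevenue {m : ℕ} (D : Set (Fin m → ℝ)) (F : Measure (Fin m → ℝ))
    (u : (Fin m → ℝ) → ℝ) : ℝ :=
  ∫ x in D, (∑ j, partialDeriv u j x * x j - u x) ∂F

/-- The supremum of `R(u; F)` over all feasible utility functions `u`. -/
def optimalUtilityRevenue {m : ℕ} (D : Set (Fin m → ℝ)) (F : Measure (Fin m → ℝ)) : EReal :=
  ⨆ (u : (Fin m → ℝ) → ℝ) (_ : IsFeasibleUtility D u), (utilityRevenue D F u : EReal)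

/-! ### Exponential valuations -/

/-- The nonnegative orthant of `ℝ^m`. -/
def orthant (m : ℕ) : Set (Fin m → ℝ) :=
  {x | ∀ j, 0 ≤ x j}

/-- The joint law of independent exponential valuations with parameters `rate j`. -/
def expLaw {m : ℕ} (rate : Fin m → ℝ) : Measure (Fin m → ℝ) :=
  Measure.pi fun j => expMeasure (rate j)

/-- The upper incomplete Gamma function `Γ(m, w)`, for positive integers `m` and `0 ≤ w`. -/
def incGamma (m : ℕ) (w : ℝ) : ℝ :=
  ∫ t in Set.Ioi w, t ^ (m - 1) * Real.exp (-t)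

/-- `g(m, w) = Γ(m + 1, w) - (m + 1) Γ(m, w)`. -/
def gFun (m : ℕ) (w : ℝ) : ℝ :=
  incGamma (m + 1) w - (m + 1) * incGamma m w

/-- The root of `g(m, ·)` in `[0, ∞)`. It is unique for `1 ≤ m`, so that the infimum below
is over a one-point set. -/
def gammaStar (m : ℕ) : ℝ :=
  sInf {w | 0 ≤ w ∧ gFun m w = 0}

/-- `G(m) = ∫_0^∞ max {0, g(m, w)} dw`. -/
def GFun (m : ℕ) : ℝ :=
  ∫ w in Set.Ioi (0 : ℝ), max 0 (gFun m w)

end OptimalSelling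

end

namespace OptimalSelling

open Set Filter Topology

/-! ### The incomplete Gamma function and the function `g` -/

/-! Everything reduces to a one-dimensional problem along rays. With `N x = ∑ λ_j x_j`, the density
on the orthant is a constant times `exp (-N x)`. On the ray `t • y` with `N y = 1`, the law
therefore has weight proportional to `t^(m-1) e^(-t)`.

Write `h t` for the buyer's utility at `t • y` and `s t` for its slope. Then `h` is convex and
nonnegative, `s` is nondecreasing with `0 ≤ s ≤ C = ∑ y_j`, and the payment is `t s(t) - h(t)`.
Since `h t ≥ ∫_0^t s`, exchanging the order of integration bounds the revenue on the ray by `∫ s(t)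
(t^m e^(-t) - Γ(m,t)) dt`. Integration by parts identifies the bracket with `g(m,t)`, so this is at
most `C G(m)` (`lintegral_ray_le`).

Along the same ray the function `∑ x_j` integrates to `m! C`. The revenue is thus dominated ray by
ray by `G(m)/m!` times the total value, whose expectation is `∑ 1/λ_j`
(`lintegral_eq_lintegral_rays`, `lintegral_expLaw_le`).

The formulas for `G(m)` hold because `g(m,w)` is the derivative of `-w Γ(m,w)` and changes sign
exactly once on `[0, ∞)`. -/

lemma continuous_pow_mul_exp_neg (n : ℕ) :
    Continuous fun t : ℝ => t ^ n * Real.exp (-t) := by fun_prop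

lemma integrableOn_pow_mul_exp_neg (n : ℕ) (w : ℝ) :
    IntegrableOn (fun t : ℝ => t ^ n * Real.exp (-t)) (Ioi w) := by
  have h0 : IntegrableOn (fun t : ℝ => t ^ n * Real.exp (-t)) (Ioi 0) := by
    have h := Real.GammaIntegral_convergent (s := n + 1) (by positivity)
    refine h.congr_fun (fun t _ => ?_) measurableSet_Ioi
    simp [mul_comm]
  have h1 : IntegrableOn (fun t : ℝ => t ^ n * Real.exp (-t)) (Icc w 0) :=
    (continuous_pow_mul_exp_neg n).continuousOn.integrableOn_Icc
  refine (h1.union h0).mono_set fun t ht => ?_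
  rcases le_or_gt t 0 with h | h
  · exact Or.inl ⟨le_of_lt ht, h⟩
  · exact Or.inr h

lemma integral_pow_mul_exp_neg (n : ℕ) :
    ∫ t in Ioi (0 : ℝ), t ^ n * Real.exp (-t) = n.factorial := by
  rw [← Real.Gamma_nat_eq_factorial, Real.Gamma_eq_integral (by positivity)]
  refine setIntegral_congr_fun measurableSet_Ioi fun t _ => ?_
  simp [mul_comm]

lemma incGamma_eq_sub (m : ℕ) (w : ℝ) :
    incGamma m w = incGamma m 0 - ∫ t in (0 : ℝ)..w, t ^ (m - 1) * Real.exp (-t) := by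
  have := intervalIntegral.integral_Ioi_sub_Ioi' (integrableOn_pow_mul_exp_neg (m - 1) 0)
    (integrableOn_pow_mul_exp_neg (m - 1) w)
  unfold incGamma
  linarith

lemma hasDerivAt_incGamma (m : ℕ) (w : ℝ) :
    HasDerivAt (incGamma m) (-(w ^ (m - 1) * Real.exp (-w))) w := by
  have h := ((continuous_pow_mul_exp_neg (m - 1)).integral_hasStrictDerivAt 0 w).hasDerivAt
  have h2 := h.const_sub (incGamma m 0)
  refine h2.congr_of_eventuallyEq (Eventually.of_forall fun x => incGamma_eq_sub m x)

lemma incGamma_nonneg (m : ℕ) {w : ℝ} (hw : 0 ≤ w) : 0 ≤ incGamma m w :=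
  setIntegral_nonneg measurableSet_Ioi fun t ht => by
    have : 0 < t := hw.trans_lt ht
    positivity

lemma tendsto_incGamma (m : ℕ) : Tendsto (incGamma m) atTop (𝓝 0) := by
  have h := intervalIntegral_tendsto_integral_Ioi 0
    (integrableOn_pow_mul_exp_neg (m - 1) 0) tendsto_id
  have h2 := h.const_sub (incGamma m 0)
  rw [show incGamma m 0 - ∫ t in Ioi (0 : ℝ), t ^ (m - 1) * Real.exp (-t) = 0 from sub_self _] at h2
  exact h2.congr fun x => (incGamma_eq_sub m x).symm

/-- Integration by parts. At `m = 0` the truncated exponent `m - 1` is harmless, because its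
coefficient vanishes. -/
lemma incGamma_succ (m : ℕ) (w : ℝ) :
    incGamma (m + 1) w = m * incGamma m w + w ^ m * Real.exp (-w) := by
  have hd : ∀ t : ℝ, HasDerivAt (fun t => -(t ^ m * Real.exp (-t)))
      (t ^ m * Real.exp (-t) - m * (t ^ (m - 1) * Real.exp (-t))) t := fun t => by
    have h := ((hasDerivAt_pow m t).mul (hasDerivAt_neg t).exp).neg
    convert! h using 1
    ring
  have i1 := integrableOn_pow_mul_exp_neg m w
  have i2 := (integrableOn_pow_mul_exp_neg (m - 1) w).const_mul (m : ℝ)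
  have h := integral_Ioi_of_hasDerivAt_of_tendsto (hd w).continuousAt.continuousWithinAt
    (fun t _ => hd t) (i1.sub i2)
    (by simpa using (Real.tendsto_pow_mul_exp_neg_atTop_nhds_zero m).neg)
  rw [integral_sub i1 i2, integral_const_mul] at h
  simp only [incGamma, add_tsub_cancel_right]
  linarith

lemma tendsto_mul_incGamma {m : ℕ} (hm : 1 ≤ m) :
    Tendsto (fun w => w * incGamma m w) atTop (𝓝 0) := by
  refine squeeze_zero' ?_ ?_ (tendsto_incGamma (m + 1))
  · filter_upwards [eventually_ge_atTop 0] with w hw using mul_nonneg hw (incGamma_nonneg m hw)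
  · filter_upwards [eventually_ge_atTop 0] with w hw
    -- On `t > w` one has `w t^(m-1) ≤ t^m`, which compares `w Γ(m,w)` with the tail `Γ(m+1,w)`.
    rw [incGamma, ← integral_const_mul]
    refine setIntegral_mono_on ((integrableOn_pow_mul_exp_neg _ _).const_mul _)
      (integrableOn_pow_mul_exp_neg _ _) measurableSet_Ioi fun t ht => ?_
    have ht0 : 0 < t := hw.trans_lt ht
    obtain ⟨k, rfl⟩ := Nat.exists_eq_add_of_le' hm
    simp only [add_tsub_cancel_right]
    rw [← mul_assoc, pow_succ']
    have := le_of_lt (mem_Ioi.1 ht)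
    gcongr

/-- This is the form in which `g` arises from the revenue on a ray. -/
lemma gFun_eq (m : ℕ) (w : ℝ) :
    gFun m w = w ^ m * Real.exp (-w) - incGamma m w := by
  rw [gFun, incGamma_succ]
  ring

lemma hasDerivAt_gFun {m : ℕ} (hm : 1 ≤ m) (w : ℝ) :
    HasDerivAt (gFun m) (w ^ (m - 1) * Real.exp (-w) * (m + 1 - w)) w := by
  have h := ((hasDerivAt_pow m w).mul (hasDerivAt_neg w).exp).sub (hasDerivAt_incGamma m w)
  refine (h.congr_deriv ?_).congr_of_eventuallyEq
    (Eventually.of_forall fun x => gFun_eq m x)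
  obtain ⟨k, rfl⟩ := Nat.exists_eq_add_of_le' hm
  simp only [add_tsub_cancel_right]
  push_cast
  ring

lemma continuous_gFun {m : ℕ} (hm : 1 ≤ m) : Continuous (gFun m) :=
  continuous_iff_continuousAt.2 fun w => (hasDerivAt_gFun hm w).continuousAt

lemma tendsto_gFun (m : ℕ) : Tendsto (gFun m) atTop (𝓝 0) := by
  have h := (Real.tendsto_pow_mul_exp_neg_atTop_nhds_zero m).sub (tendsto_incGamma m)
  simp only [sub_zero] at h
  exact h.congr fun w => (gFun_eq m w).symm

lemma gFun_zero_neg {m : ℕ} (hm : 1 ≤ m) : gFun m 0 < 0 := by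
  have h : incGamma m 0 = (m - 1).factorial := integral_pow_mul_exp_neg _
  rw [gFun_eq m, h, zero_pow (by lia)]
  have : (0 : ℝ) < (m - 1).factorial := by positivity
  linarith

lemma strictMonoOn_gFun {m : ℕ} (hm : 1 ≤ m) : StrictMonoOn (gFun m) (Icc 0 (m + 1)) := by
  refine strictMonoOn_of_deriv_pos (convex_Icc _ _) (continuous_gFun hm).continuousOn fun w hw => ?_
  rw [interior_Icc] at hw
  rw [(hasDerivAt_gFun hm w).deriv]
  have h1 := hw.1
  have h2 : 0 < m + 1 - w := sub_pos.2 hw.2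
  positivity

lemma strictAntiOn_gFun {m : ℕ} (hm : 1 ≤ m) : StrictAntiOn (gFun m) (Ici (m + 1)) := by
  refine strictAntiOn_of_deriv_neg (convex_Ici _) (continuous_gFun hm).continuousOn fun w hw => ?_
  rw [interior_Ici] at hw
  rw [(hasDerivAt_gFun hm w).deriv]
  have h2 : m + 1 - w < 0 := sub_neg.2 hw
  have h1 : 0 < w := lt_trans (by positivity) (mem_Ioi.1 hw)
  exact mul_neg_of_pos_of_neg (by positivity) h2

/-- Past `m + 1` the function decreases strictly to its limit `0`, so it stays above it. -/
lemma gFun_pos_of_ge {m : ℕ} (hm : 1 ≤ m) {w : ℝ} (hw : m + 1 ≤ w) : 0 < gFun m w := by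
  have h1 : gFun m (w + 1) < gFun m w :=
    strictAntiOn_gFun hm hw (mem_Ici.2 (by linarith)) (by linarith)
  refine lt_of_le_of_lt (le_of_tendsto (tendsto_gFun m) ?_) h1
  filter_upwards [eventually_ge_atTop (w + 1)] with v hv
  exact strictAntiOn_gFun hm |>.antitoneOn (mem_Ici.2 (by linarith)) (mem_Ici.2 (by linarith)) hv

/-- `g` starts negative, increases up to `m + 1`, and is positive from there on, so it crosses zero
once, on the increasing stretch. -/
lemma exists_gFun_root {m : ℕ} (hm : 1 ≤ m) :
    ∃ γ : ℝ, 0 < γ ∧ gFun m γ = 0 ∧ (∀ w, 0 ≤ w → w < γ → gFun m w < 0) ∧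
      ∀ w, γ < w → 0 < gFun m w := by
  have hM : (0 : ℝ) ≤ m + 1 := by positivity
  obtain ⟨γ, hγ, h0⟩ := intermediate_value_Icc hM (continuous_gFun hm).continuousOn
    (show (0 : ℝ) ∈ _ from ⟨(gFun_zero_neg hm).le, (gFun_pos_of_ge hm le_rfl).le⟩)
  refine ⟨γ, lt_of_le_of_ne hγ.1 ?_, h0, fun w hw hwγ => ?_, fun w hw => ?_⟩
  · rintro rfl
    exact (gFun_zero_neg hm).ne h0
  · rw [← h0]
    exact strictMonoOn_gFun hm ⟨hw, hwγ.le.trans hγ.2⟩ hγ hwγ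
  · rcases le_total w (m + 1) with h | h
    · rw [← h0]
      exact strictMonoOn_gFun hm hγ ⟨hγ.1.trans hw.le, h⟩ hw
    · exact gFun_pos_of_ge hm h

lemma eq_gammaStar_iff {m : ℕ} (hm : 1 ≤ m) (w : ℝ) :
    (0 ≤ w ∧ gFun m w = 0) ↔ w = gammaStar m := by
  obtain ⟨γ, hγ, h0, hlt, hgt⟩ := exists_gFun_root hm
  have key : ∀ w, (0 ≤ w ∧ gFun m w = 0) ↔ w = γ := fun w => by
    constructor
    · rintro ⟨hw, hg⟩
      rcases lt_trichotomy w γ with h | h | h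
      · exact absurd hg (hlt w hw h).ne
      · exact h
      · exact absurd hg (hgt w h).ne'
    · rintro rfl
      exact ⟨hγ.le, h0⟩
  have : gammaStar m = γ := by simp [gammaStar, key]
  rw [this, key]

lemma gammaStar_nonneg {m : ℕ} (hm : 1 ≤ m) : 0 ≤ gammaStar m :=
  ((eq_gammaStar_iff hm _).2 rfl).1

lemma gFun_gammaStar {m : ℕ} (hm : 1 ≤ m) : gFun m (gammaStar m) = 0 :=
  ((eq_gammaStar_iff hm _).2 rfl).2

lemma gFun_nonpos_of_le_gammaStar {m : ℕ} (hm : 1 ≤ m) {w : ℝ} (hw : 0 ≤ w)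
    (h : w ≤ gammaStar m) : gFun m w ≤ 0 := by
  obtain ⟨γ, hγ, h0, hlt, -⟩ := exists_gFun_root hm
  rw [← (eq_gammaStar_iff hm γ).1 ⟨hγ.le, h0⟩] at h
  rcases h.eq_or_lt with rfl | h
  · exact h0.le
  · exact (hlt w hw h).le

lemma gFun_nonneg_of_gammaStar_le {m : ℕ} (hm : 1 ≤ m) {w : ℝ}
    (h : gammaStar m ≤ w) : 0 ≤ gFun m w := by
  obtain ⟨γ, hγ, h0, -, hgt⟩ := exists_gFun_root hm
  rw [← (eq_gammaStar_iff hm γ).1 ⟨hγ.le, h0⟩] at h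
  rcases h.eq_or_lt with rfl | h
  · exact h0.ge
  · exact (hgt w h).le

/-! ### The value of `G` -/

/-- This primitive vanishes at infinity, so the integral of `g` over a tail is read off at the left
endpoint. -/
lemma hasDerivAt_neg_mul_incGamma {m : ℕ} (hm : 1 ≤ m) (w : ℝ) :
    HasDerivAt (fun w => -(w * incGamma m w)) (gFun m w) w := by
  refine ((hasDerivAt_id w).mul (hasDerivAt_incGamma m w)).neg.congr_deriv ?_
  rw [gFun_eq m]
  obtain ⟨k, rfl⟩ := Nat.exists_eq_add_of_le' hm
  simp only [add_tsub_cancel_right, id]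
  ring

lemma integrableOn_gFun {m : ℕ} (hm : 1 ≤ m) : IntegrableOn (gFun m) (Ioi (gammaStar m)) :=
  integrableOn_Ioi_deriv_of_nonneg' (fun w _ => hasDerivAt_neg_mul_incGamma hm w)
    (fun _ hw => gFun_nonneg_of_gammaStar_le hm (le_of_lt hw))
    (by simpa using (tendsto_mul_incGamma hm).neg)

lemma integral_gFun {m : ℕ} (hm : 1 ≤ m) :
    ∫ w in Ioi (gammaStar m), gFun m w = gammaStar m * incGamma m (gammaStar m) := by
  rw [integral_Ioi_of_hasDerivAt_of_tendsto' (fun w _ => hasDerivAt_neg_mul_incGamma hm w)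
    (integrableOn_gFun hm) (by simpa using (tendsto_mul_incGamma hm).neg)]
  ring

lemma integrableOn_max_gFun {m : ℕ} (hm : 1 ≤ m) :
    IntegrableOn (fun w => max 0 (gFun m w)) (Ioi 0) := by
  have h1 : IntegrableOn (fun w => max 0 (gFun m w)) (Icc 0 (gammaStar m)) :=
    (continuous_const.max (continuous_gFun hm)).continuousOn.integrableOn_Icc
  have h2 : IntegrableOn (fun w => max 0 (gFun m w)) (Ioi (gammaStar m)) :=
    (integrableOn_gFun hm).congr_fun (fun w hw =>
      (max_eq_right (gFun_nonneg_of_gammaStar_le hm (le_of_lt hw))).symm) measurableSet_Ioi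
  refine (h1.union h2).mono_set fun t ht => ?_
  rcases le_or_gt t (gammaStar m) with h | h
  · exact Or.inl ⟨le_of_lt ht, h⟩
  · exact Or.inr h

lemma GFun_eq_integral_gFun {m : ℕ} (hm : 1 ≤ m) :
    GFun m = ∫ w in Ioi (gammaStar m), gFun m w := by
  rw [GFun, setIntegral_eq_of_subset_of_forall_sdiff_eq_zero measurableSet_Ioi
    (Ioi_subset_Ioi (gammaStar_nonneg hm)) fun w hw =>
      max_eq_left (gFun_nonpos_of_le_gammaStar hm (le_of_lt hw.1) (not_lt.1 hw.2))]
  exact setIntegral_congr_fun measurableSet_Ioi fun w hw =>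
    max_eq_right (gFun_nonneg_of_gammaStar_le hm (le_of_lt hw))

lemma GFun_eq_mul_incGamma {m : ℕ} (hm : 1 ≤ m) :
    GFun m = gammaStar m * incGamma m (gammaStar m) :=
  (GFun_eq_integral_gFun hm).trans (integral_gFun hm)

/-- At the root, `g = 0` says that `Γ(m,γ) = γ^m e^(-γ)`. -/
lemma GFun_eq_pow_mul_exp {m : ℕ} (hm : 1 ≤ m) :
    GFun m = gammaStar m ^ (m + 1) * Real.exp (-gammaStar m) := by
  have h := gFun_gammaStar hm
  rw [gFun_eq m, sub_eq_zero] at h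
  rw [GFun_eq_mul_incGamma hm, ← h]
  ring

lemma GFun_nonneg (m : ℕ) : 0 ≤ GFun m :=
  setIntegral_nonneg measurableSet_Ioi fun _ _ => le_max_left _ _

/-! ### Revenue along a ray -/

lemma convexOn_of_subgradient {S : Set ℝ} (hS : Convex ℝ S) {h s : ℝ → ℝ}
    (hsub : ∀ t ∈ S, ∀ t' ∈ S, h t + s t * (t' - t) ≤ h t') : ConvexOn ℝ S h := by
  refine ⟨hS, fun x hx y hy a b ha hb hab => ?_⟩
  have hw := hS hx hy ha hb hab
  have h1 := mul_le_mul_of_nonneg_left (hsub _ hw x hx) ha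
  have h2 := mul_le_mul_of_nonneg_left (hsub _ hw y hy) hb
  simp only [smul_eq_mul] at *
  obtain rfl : b = 1 - a := by linarith
  linarith

lemma monotoneOn_of_subgradient {S : Set ℝ} {h s : ℝ → ℝ}
    (hsub : ∀ t ∈ S, ∀ t' ∈ S, h t + s t * (t' - t) ≤ h t') : MonotoneOn s S := by
  intro x hx y hy hxy
  rcases hxy.eq_or_lt with rfl | hxy
  · exact le_rfl
  have h1 := hsub x hx y hy
  have h2 := hsub y hy x hx
  by_contra! hc
  nlinarith [mul_pos (sub_pos.2 hxy) (sub_pos.2 hc)]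

/-- Any selection of subgradients lies below the right derivative of the convex function `h`, and
`h` is recovered from its right derivative by integration. -/
lemma integral_subgradient_le {h s : ℝ → ℝ}
    (hsub : ∀ t ∈ Ioi (0 : ℝ), ∀ t' ∈ Ioi (0 : ℝ), h t + s t * (t' - t) ≤ h t')
    {a b : ℝ} (ha : 0 < a) (hab : a ≤ b) : ∫ t in a..b, s t ≤ h b - h a := by
  have hconv := convexOn_of_subgradient (convex_Ioi 0) hsub
  have hss : Icc a b ⊆ Ioi 0 := fun x hx => ha.trans_le hx.1
  refine intervalIntegral.integral_le_sub_of_hasDeriv_right_of_le (g' := fun x =>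
      derivWithin h (Ioi x) x) hab
    ((hconv.continuousOn isOpen_Ioi).mono hss) (fun x hx => ?_)
    (((monotoneOn_of_subgradient hsub).mono hss).integrableOn_isCompact isCompact_Icc) ?_
  · exact hconv.hasDerivWithinAt_rightDeriv_of_mem_interior
      (by rw [interior_Ioi]; exact ha.trans hx.1)
  · intro x hx
    have hx0 : 0 < x := ha.trans hx.1
    have hd := hconv.hasDerivWithinAt_rightDeriv_of_mem_interior
      (x := x) (by rwa [interior_Ioi])
    rw [hasDerivWithinAt_iff_tendsto_slope' (by simp)] at hd
    refine ge_of_tendsto hd ?_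
    filter_upwards [self_mem_nhdsWithin] with y hy
    have hy' : 0 < y - x := sub_pos.2 hy
    rw [slope_def_field, le_div_iff₀ hy']
    linarith [hsub x hx0 y (hx0.trans hy)]

/-- In essence `∫_0^t S ≤ h t`, phrased with positive parts. Where `t S(t) - h(t)` is negative,
monotonicity of `S` gives the bound instead. -/
lemma lintegral_subgradient_le {C : ℝ} {h S : ℝ → ℝ} (hh : ∀ t, 0 < t → 0 ≤ h t)
    (hS : Monotone S) (hS0 : ∀ t, 0 ≤ S t) (hSC : ∀ t, S t ≤ C)
    (hsub : ∀ t ∈ Ioi (0 : ℝ), ∀ t' ∈ Ioi (0 : ℝ), h t + S t * (t' - t) ≤ h t')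
    {t : ℝ} (ht : 0 < t) :
    ENNReal.ofReal (t * S t - h t) + ∫⁻ x in Ioc 0 t, ENNReal.ofReal (S x) ≤
      ENNReal.ofReal (t * S t) := by
  have hint : ∀ a b : ℝ, IntervalIntegrable S volume a b := fun a b => hS.intervalIntegrable
  have h1 : ∫⁻ x in Ioc 0 t, ENNReal.ofReal (S x) = ENNReal.ofReal (∫ x in (0 : ℝ)..t, S x) := by
    rw [intervalIntegral.integral_of_le ht.le, ofReal_integral_eq_lintegral_ofReal (hint 0 t).1
      (ae_of_all _ hS0)]
  have h2 : ∫ x in (0 : ℝ)..t, S x ≤ t * S t := by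
    have := intervalIntegral.integral_mono_on ht.le (hint 0 t)
      (intervalIntegrable_const (c := S t)) fun x hx => hS hx.2
    simpa using this
  have h3 : ∫ x in (0 : ℝ)..t, S x ≤ h t := by
    refine le_of_forall_pos_le_add fun δ hδ => ?_
    have hC : 0 ≤ C := (hS0 0).trans (hSC 0)
    -- Nothing is assumed about `h` at `0`, so the subgradient estimate is used on `[ε, t]`. The
    -- piece on `[0, ε]` costs at most `ε C ≤ δ`; the `+ 1` covers `C = 0`.
    set ε := min t (δ / (C + 1))
    have hε0 : 0 < ε := lt_min ht (by positivity)
    have hεδ : ε * C ≤ δ := by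
      have h5 : ε ≤ δ / (C + 1) := min_le_right _ _
      rw [le_div_iff₀ (by positivity)] at h5
      linarith
    have h4 := intervalIntegral.integral_mono_on hε0.le (hint 0 ε)
      (intervalIntegrable_const (c := C)) fun x _ => hSC x
    simp only [intervalIntegral.integral_const, sub_zero, smul_eq_mul] at h4
    have h5 := integral_subgradient_le hsub hε0 (min_le_left t (δ / (C + 1)))
    rw [← intervalIntegral.integral_add_adjacent_intervals (hint 0 ε) (hint ε t)]
    linarith [hh ε hε0]
  have h4 : 0 ≤ ∫ x in (0 : ℝ)..t, S x :=
    intervalIntegral.integral_nonneg ht.le fun x _ => hS0 x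
  rw [h1]
  rcases le_total 0 (t * S t - h t) with h5 | h5
  · rw [← ENNReal.ofReal_add h5 h4]
    exact ENNReal.ofReal_le_ofReal (by linarith)
  · rw [ENNReal.ofReal_of_nonpos h5, zero_add]
    exact ENNReal.ofReal_le_ofReal h2

/-- Tonelli on the region `0 < x ≤ t`: integrating the weight over `t ≥ x` gives `Γ(m,x)`. -/
lemma lintegral_gammaWeight_mul_lintegral (m : ℕ) {σ : ℝ → ENNReal} (hσ : Measurable σ) :
    ∫⁻ t in Ioi (0 : ℝ), ENNReal.ofReal (t ^ (m - 1) * Real.exp (-t)) * ∫⁻ x in Ioc 0 t, σ x =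
      ∫⁻ x in Ioi (0 : ℝ), ENNReal.ofReal (incGamma m x) * σ x := by
  set ω : ℝ → ENNReal := fun t => ENNReal.ofReal (t ^ (m - 1) * Real.exp (-t)) with hω
  have hωm : Measurable ω := by fun_prop
  set F : ℝ → ℝ → ENNReal := fun t x => if x ≤ t then ω t * σ x else 0
  have hFm : Measurable (Function.uncurry F) := by
    refine Measurable.ite (measurableSet_le measurable_snd measurable_fst) ?_ measurable_const
    fun_prop
  have h1 : ∀ t, ω t * ∫⁻ x in Ioc 0 t, σ x = ∫⁻ x in Ioi (0 : ℝ), F t x := fun t => by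
    have : F t = (Iic t).indicator fun x => ω t * σ x := by
      ext x
      simp [F, indicator]
    rw [this, lintegral_indicator measurableSet_Iic, Measure.restrict_restrict measurableSet_Iic,
      inter_comm, Ioi_inter_Iic, lintegral_const_mul _ hσ]
  have h2 : ∀ x ∈ Ioi (0 : ℝ), ∫⁻ t in Ioi (0 : ℝ), F t x = ENNReal.ofReal (incGamma m x) * σ x := by
    intro x hx
    have : (fun t => F t x) = (Ici x).indicator fun t => ω t * σ x := by
      ext t
      simp [F, indicator]
    rw [this, lintegral_indicator measurableSet_Ici, Measure.restrict_restrict measurableSet_Ici,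
      inter_eq_left.2 (Ici_subset_Ioi.2 hx), lintegral_mul_const _ hωm,
      ← restrict_Ioi_eq_restrict_Ici, incGamma, ofReal_integral_eq_lintegral_ofReal
        (integrableOn_pow_mul_exp_neg _ _)]
    refine (ae_restrict_mem measurableSet_Ioi).mono fun t ht => ?_
    have : 0 < t := lt_trans hx ht
    simp only [Pi.zero_apply]
    positivity
  refine (lintegral_congr h1).trans ?_
  rw [lintegral_lintegral_swap hFm.aemeasurable]
  exact setLIntegral_congr_fun measurableSet_Ioi h2

lemma lintegral_ray_le {m : ℕ} (hm : 1 ≤ m) {C : ℝ} {h s : ℝ → ℝ} (hh : ∀ t, 0 < t → 0 ≤ h t)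
    (hs0 : ∀ t, 0 < t → 0 ≤ s t) (hsC : ∀ t, 0 < t → s t ≤ C)
    (hsub : ∀ t ∈ Ioi (0 : ℝ), ∀ t' ∈ Ioi (0 : ℝ), h t + s t * (t' - t) ≤ h t') :
    ∫⁻ t in Ioi (0 : ℝ), ENNReal.ofReal (t ^ (m - 1) * Real.exp (-t)) *
      ENNReal.ofReal (t * s t - h t) ≤ ENNReal.ofReal (C * GFun m) := by
  have hC : 0 ≤ C := (hs0 1 one_pos).trans (hsC 1 one_pos)
  -- Extension by zero makes the slope monotone on all of `ℝ`, hence measurable.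
  set S : ℝ → ℝ := fun t => if 0 < t then s t else 0
  have hSs : ∀ t, 0 < t → S t = s t := fun t ht => if_pos ht
  have hS0 : ∀ t, 0 ≤ S t := fun t => by
    by_cases ht : 0 < t
    · exact (hSs t ht).symm ▸ hs0 t ht
    · simp [S, ht]
  have hSC : ∀ t, S t ≤ C := fun t => by
    by_cases ht : 0 < t
    · exact (hSs t ht).symm ▸ hsC t ht
    · simpa [S, ht] using hC
  have hS : Monotone S := fun x y hxy => by
    by_cases hx : 0 < x
    · have hy := hx.trans_le hxy
      rw [hSs x hx, hSs y hy]
      exact monotoneOn_of_subgradient hsub hx hy hxy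
    · simpa [S, hx] using hS0 y
  have hsub' : ∀ t ∈ Ioi (0 : ℝ), ∀ t' ∈ Ioi (0 : ℝ), h t + S t * (t' - t) ≤ h t' :=
    fun t ht t' ht' => by rw [hSs t ht]; exact hsub t ht t' ht'
  set ω : ℝ → ENNReal := fun t => ENNReal.ofReal (t ^ (m - 1) * Real.exp (-t)) with hω
  have hωm : Measurable ω := by fun_prop
  have hσm : Measurable fun x => ENNReal.ofReal (S x) := hS.measurable.ennreal_ofReal
  have hΓm : Measurable fun x => ENNReal.ofReal (incGamma m x) * ENNReal.ofReal (S x) :=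
    ((continuous_iff_continuousAt.2 fun w =>
      (hasDerivAt_incGamma m w).continuousAt).measurable.ennreal_ofReal).mul hσm
  have hpow : ∀ t : ℝ, t ^ (m - 1) * t = t ^ m := fun t => by
    rw [← pow_succ, Nat.sub_add_cancel hm]
  have hA := lintegral_gammaWeight_mul_lintegral m hσm
  set A := ∫⁻ x in Ioi (0 : ℝ), ENNReal.ofReal (incGamma m x) * ENNReal.ofReal (S x)
  have hle : (∫⁻ t in Ioi (0 : ℝ), ω t * ENNReal.ofReal (t * s t - h t)) + A ≤
      ∫⁻ t in Ioi (0 : ℝ), ω t * ENNReal.ofReal (t * S t) := by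
    rw [← hA]
    -- Superadditivity of the lower integral needs no measurability of the revenue term.
    refine (le_lintegral_add _ _).trans (setLIntegral_mono' measurableSet_Ioi fun t ht => ?_)
    rw [← mul_add, ← hSs t ht]
    gcongr
    exact lintegral_subgradient_le hh hS hS0 hSC hsub' ht
  have hup : ∫⁻ t in Ioi (0 : ℝ), ω t * ENNReal.ofReal (t * S t) ≤
      A + ENNReal.ofReal (C * GFun m) := by
    have h1 : ENNReal.ofReal (C * GFun m) =
        ∫⁻ t in Ioi (0 : ℝ), ENNReal.ofReal (C * max 0 (gFun m t)) := by
      rw [GFun, ← integral_const_mul, ofReal_integral_eq_lintegral_ofReal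
        ((integrableOn_max_gFun hm).const_mul C)
        (ae_of_all _ fun t => mul_nonneg hC (le_max_left _ _))]
    rw [h1, ← lintegral_add_left hΓm]
    refine setLIntegral_mono' measurableSet_Ioi fun t (ht : 0 < t) => ?_
    have hg := gFun_eq m t
    have hΓ := incGamma_nonneg m ht.le
    rw [hω]
    dsimp only
    rw [← ENNReal.ofReal_mul (by positivity), ← ENNReal.ofReal_mul hΓ,
      ← ENNReal.ofReal_add (mul_nonneg hΓ (hS0 t)) (mul_nonneg hC (le_max_left _ _))]
    refine ENNReal.ofReal_le_ofReal ?_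
    -- The only loss here: the slope is replaced by `C` where `g > 0` and by `0` where `g < 0`.
    have h2 : S t * gFun m t ≤ C * max 0 (gFun m t) :=
      (mul_le_mul_of_nonneg_left (le_max_right 0 _) (hS0 t)).trans
        (mul_le_mul_of_nonneg_right (hSC t) (le_max_left _ _))
    rw [hg] at h2 ⊢
    calc t ^ (m - 1) * Real.exp (-t) * (t * S t) = t ^ (m - 1) * t * Real.exp (-t) * S t := by ring
      _ ≤ _ := by rw [hpow]; linarith
  have hfin : ∫⁻ t in Ioi (0 : ℝ), ω t * ENNReal.ofReal (t * S t) ≠ ⊤ := by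
    have hi := ((integrableOn_pow_mul_exp_neg m 0).const_mul C).lintegral_lt_top
    refine (lt_of_le_of_lt (setLIntegral_mono' measurableSet_Ioi fun t (ht : 0 < t) => ?_) hi).ne
    rw [hω]
    dsimp only
    rw [← ENNReal.ofReal_mul (by positivity)]
    refine ENNReal.ofReal_le_ofReal ?_
    calc t ^ (m - 1) * Real.exp (-t) * (t * S t) = S t * (t ^ (m - 1) * t * Real.exp (-t)) := by ring
      _ ≤ C * (t ^ m * Real.exp (-t)) := by
        rw [hpow]
        exact mul_le_mul_of_nonneg_right (hSC t) (by positivity)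
  -- `A` has to be finite to be cancelled from both sides.
  have hAfin : A ≠ ⊤ := ne_top_of_le_ne_top hfin (le_add_self.trans hle)
  refine (ENNReal.add_le_add_iff_right hAfin).1 ?_
  rw [add_comm (ENNReal.ofReal _)]
  exact hle.trans hup

/-! ### Integration along rays -/

lemma lintegral_eq_mul_lintegral_comp_smul {E : Type*} [NormedAddCommGroup E] [NormedSpace ℝ E]
    [MeasurableSpace E] [BorelSpace E] [FiniteDimensional ℝ E] (μ : Measure E)
    [μ.IsAddHaarMeasure] {f : E → ENNReal} (hf : Measurable f) {c : ℝ} (hc : 0 < c) :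
    ∫⁻ x, f x ∂μ = ENNReal.ofReal (c ^ Module.finrank ℝ E) * ∫⁻ x, f (c • x) ∂μ := by
  have hcn : 0 < c ^ Module.finrank ℝ E := by positivity
  have h : ∫⁻ x, f (c • x) ∂μ = ∫⁻ x, f x ∂(Measure.map (c • ·) μ) :=
    (lintegral_map hf (measurable_const_smul c)).symm
  rw [h, Measure.map_addHaar_smul μ hc.ne', lintegral_smul_measure, smul_eq_mul, ← mul_assoc,
    abs_of_pos (inv_pos.2 hcn), ← ENNReal.ofReal_mul hcn.le, mul_inv_cancel₀ hcn.ne',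
    ENNReal.ofReal_one, one_mul]

lemma setLIntegral_Ioi_eq_mul_comp_mul {f : ℝ → ENNReal} (hf : Measurable f) {c : ℝ}
    (hc : 0 < c) :
    ∫⁻ t in Ioi (0 : ℝ), f t = ENNReal.ofReal c * ∫⁻ t in Ioi (0 : ℝ), f (c * t) := by
  rw [← lintegral_indicator measurableSet_Ioi,
    lintegral_eq_mul_lintegral_comp_smul volume (hf.indicator measurableSet_Ioi) hc,
    ← lintegral_indicator measurableSet_Ioi]
  simp only [Module.finrank_self, pow_one, smul_eq_mul]
  congr 2 with t
  simp [indicator, hc]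

/-- Disintegration of the Lebesgue measure along rays: `N` is positively homogeneous, and the
point `(r / N z) • z` is where `N` has the value `r` on the ray through `z`. -/
lemma lintegral_eq_lintegral_rays {m : ℕ} (hm : 1 ≤ m) {N : (Fin m → ℝ) → ℝ} (hN : Measurable N)
    (hhom : ∀ c : ℝ, ∀ x, N (c • x) = c * N x) {f : (Fin m → ℝ) → ENNReal}
    (hf : Measurable f) :
    ∫⁻ x in {x | 0 < N x}, f x =
      ∫⁻ z in {z | 1 ≤ N z}, ENNReal.ofReal ((N z ^ (m + 1))⁻¹) *
        ∫⁻ r in Ioi (0 : ℝ), ENNReal.ofReal (r ^ (m - 1)) * f (r • (N z)⁻¹ • z) := by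
  have hpos : MeasurableSet {x | 0 < N x} := measurableSet_lt measurable_const hN
  -- Averaging over `0 < t ≤ N x` writes `f x` as an integral in `t`. After swapping and
  -- substituting `x = t • z`, the constraint `t ≤ N x` becomes `1 ≤ N z`, independent of `t`. No
  -- surface measure is needed.
  set F : (Fin m → ℝ) → ℝ → ENNReal :=
    fun x t => if t ≤ N x then ENNReal.ofReal ((N x)⁻¹) * f x else 0
  have hFm : Measurable (Function.uncurry F) := by
    refine Measurable.ite (measurableSet_le measurable_snd (hN.comp measurable_fst)) ?_
      measurable_const
    fun_prop
  set H : ℝ → (Fin m → ℝ) → ENNReal :=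
    fun t z => ENNReal.ofReal (t ^ m) * F (t • z) t
  have hHm : Measurable (Function.uncurry H) := by
    have h1 : Measurable fun q : ℝ × (Fin m → ℝ) => (q.1 • q.2, q.1) := by fun_prop
    exact (by fun_prop : Measurable fun q : ℝ × (Fin m → ℝ) => ENNReal.ofReal (q.1 ^ m)).mul
      (hFm.comp h1)
  have e1 : ∀ x ∈ {x | 0 < N x}, f x = ∫⁻ t in Ioi (0 : ℝ), F x t := by
    intro x (hx : 0 < N x)
    have h1 : F x = (Iic (N x)).indicator fun _ => ENNReal.ofReal ((N x)⁻¹) * f x := by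
      ext t
      simp [F, indicator]
    rw [h1, lintegral_indicator measurableSet_Iic, Measure.restrict_restrict measurableSet_Iic,
      inter_comm, Ioi_inter_Iic, setLIntegral_const, Real.volume_Ioc, sub_zero, mul_right_comm,
      ← ENNReal.ofReal_mul (inv_pos.2 hx).le, inv_mul_cancel₀ hx.ne', ENNReal.ofReal_one, one_mul]
  have e2 : ∀ t ∈ Ioi (0 : ℝ), ∫⁻ x in {x | 0 < N x}, F x t = ∫⁻ z, H t z := by
    intro t (ht : 0 < t)
    have hFt : Measurable fun x => F x t := hFm.comp (by fun_prop : Measurable fun x => (x, t))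
    have h1 : ({x | 0 < N x}.indicator fun x => F x t) = fun x => F x t := by
      rw [indicator_eq_self]
      intro x hx
      by_contra hc
      have : ¬ t ≤ N x := fun h => hc (ht.trans_le h)
      simp [F, this] at hx
    have hFt' : Measurable fun z => F (t • z) t := hFt.comp (measurable_const_smul t)
    rw [← lintegral_indicator hpos, h1, lintegral_eq_mul_lintegral_comp_smul volume hFt ht,
      ← lintegral_const_mul _ hFt']
    simp [H]
  have e3 : ∀ z, ∫⁻ t in Ioi (0 : ℝ), H t z = {z | 1 ≤ N z}.indicator (fun z =>
      ENNReal.ofReal ((N z ^ (m + 1))⁻¹) *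
        ∫⁻ r in Ioi (0 : ℝ), ENNReal.ofReal (r ^ (m - 1)) * f (r • (N z)⁻¹ • z)) z := by
    intro z
    have hiff : ∀ t : ℝ, 0 < t → (t ≤ t * N z ↔ 1 ≤ N z) := fun t ht => by
      rw [le_mul_iff_one_le_right ht]
    by_cases hz : 1 ≤ N z
    · have hNz : 0 < N z := one_pos.trans_le hz
      have hHz : Measurable fun t => H t z :=
        hHm.comp (by fun_prop : Measurable fun t : ℝ => (t, z))
      have hHz' : Measurable fun r => H ((N z)⁻¹ * r) z := hHz.comp (measurable_const_mul _)
      rw [indicator_of_mem (show z ∈ {z | 1 ≤ N z} from hz),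
        setLIntegral_Ioi_eq_mul_comp_mul hHz (inv_pos.2 hNz), ← lintegral_const_mul _ hHz',
        ← lintegral_const_mul _ (by fun_prop)]
      refine setLIntegral_congr_fun measurableSet_Ioi fun r (hr : 0 < r) => ?_
      have hr' : 0 < (N z)⁻¹ * r := by positivity
      simp only [H, F, hhom, hiff _ hr', hz, if_true]
      have h2 : ((N z)⁻¹ * r) • z = r • (N z)⁻¹ • z := by rw [smul_smul, mul_comm]
      rw [h2, ← mul_assoc, ← mul_assoc, ← mul_assoc, ← ENNReal.ofReal_mul (by positivity),
        ← ENNReal.ofReal_mul (by positivity), ← ENNReal.ofReal_mul (by positivity)]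
      congr 2
      obtain ⟨k, rfl⟩ := Nat.exists_eq_add_of_le' hm
      rw [add_tsub_cancel_right, mul_pow, inv_pow]
      field_simp
      ring
    · rw [indicator_of_notMem (show z ∉ {z | 1 ≤ N z} from hz)]
      refine (setLIntegral_congr_fun measurableSet_Ioi fun t ht => ?_).trans lintegral_zero
      simp [H, F, hhom, hiff t ht, hz]
  rw [setLIntegral_congr_fun hpos e1, lintegral_lintegral_swap hFm.aemeasurable,
    setLIntegral_congr_fun measurableSet_Ioi e2, lintegral_lintegral_swap hHm.aemeasurable,
    lintegral_congr e3, lintegral_indicator (measurableSet_le measurable_const hN)]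

/-- Needed because a feasible utility is controlled only almost everywhere. The disintegration is
applied to a measurable null set containing the exceptional points. -/
lemma ae_ae_ray {m : ℕ} (hm : 1 ≤ m) {N : (Fin m → ℝ) → ℝ} (hN : Measurable N)
    (hhom : ∀ c : ℝ, ∀ x, N (c • x) = c * N x) {P : (Fin m → ℝ) → Prop}
    (hP : ∀ᵐ x, P x) :
    ∀ᵐ z, 1 ≤ N z → ∀ᵐ r ∂(volume.restrict (Ioi (0 : ℝ))), P (r • (N z)⁻¹ • z) := by
  set B := toMeasurable volume {x | ¬ P x} with hB
  have hBm : MeasurableSet B := measurableSet_toMeasurable _ _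
  have hB0 : volume B = 0 := by rw [hB, measure_toMeasurable]; exact hP
  have hone : Measurable (B.indicator (1 : (Fin m → ℝ) → ENNReal)) := measurable_one.indicator hBm
  have h := lintegral_eq_lintegral_rays hm hN hhom hone
  have h0 : ∫⁻ x in {x | 0 < N x}, B.indicator (1 : (Fin m → ℝ) → ENNReal) x = 0 := by
    refine le_antisymm ((setLIntegral_le_lintegral _ _).trans ?_) bot_le
    rw [lintegral_indicator_one hBm, hB0]
  have hmeas : Measurable (Function.uncurry fun (z : Fin m → ℝ) (r : ℝ) =>
      ENNReal.ofReal (r ^ (m - 1)) * B.indicator (1 : (Fin m → ℝ) → ENNReal) (r • (N z)⁻¹ • z)) :=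
    by fun_prop
  have hmeas' : Measurable fun z => ENNReal.ofReal ((N z ^ (m + 1))⁻¹) *
      ∫⁻ r in Ioi (0 : ℝ), ENNReal.ofReal (r ^ (m - 1)) *
        B.indicator (1 : (Fin m → ℝ) → ENNReal) (r • (N z)⁻¹ • z) :=
    (by fun_prop : Measurable fun z => ENNReal.ofReal ((N z ^ (m + 1))⁻¹)).mul
      hmeas.lintegral_prod_right'
  rw [h0, eq_comm, lintegral_eq_zero_iff hmeas', EventuallyEq,
    ae_restrict_iff' (measurableSet_le measurable_const hN)] at h
  filter_upwards [h] with z hz h1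
  have hNz : 0 < N z := one_pos.trans_le h1
  have h2 := hz h1
  have h3 : ENNReal.ofReal ((N z ^ (m + 1))⁻¹) ≠ 0 := by
    rw [Ne, ENNReal.ofReal_eq_zero, not_le]
    positivity
  have h4 := (mul_eq_zero.1 h2).resolve_left h3
  rw [lintegral_eq_zero_iff (by fun_prop)] at h4
  filter_upwards [h4, ae_restrict_mem measurableSet_Ioi] with r hr (hr0 : 0 < r)
  have h5 : ENNReal.ofReal (r ^ (m - 1)) ≠ 0 := by
    rw [Ne, ENNReal.ofReal_eq_zero, not_le]
    positivity
  have h6 := (mul_eq_zero.1 hr).resolve_left h5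
  by_contra hc
  have : r • (N z)⁻¹ • z ∈ B := subset_toMeasurable _ _ hc
  simp [this] at h6

/-! ### The exponential law -/

lemma pi_withDensity_ofReal {ι : Type*} [Fintype ι] {f : ι → ℝ → ℝ}
    (h0 : ∀ i x, 0 ≤ f i x) (hi : ∀ i, Integrable (f i)) :
    Measure.pi (fun i => volume.withDensity fun x => ENNReal.ofReal (f i x)) =
      volume.withDensity fun x : ι → ℝ => ENNReal.ofReal (∏ i, f i (x i)) := by
  refine Measure.pi_eq fun s hs => ?_
  rw [withDensity_apply _ (MeasurableSet.univ_pi hs), volume_pi, Measure.restrict_pi_pi]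
  rw [← ofReal_integral_eq_lintegral_ofReal
    (Integrable.fintype_prod fun i => (hi i).restrict)
    (ae_of_all _ fun x => Finset.prod_nonneg fun i _ => h0 i _),
    integral_fintype_prod_eq_prod, ENNReal.ofReal_prod_of_nonneg fun i _ =>
      integral_nonneg fun x => h0 i x]
  refine Finset.prod_congr rfl fun i _ => ?_
  rw [withDensity_apply _ (hs i), ofReal_integral_eq_lintegral_ofReal (hi i).restrict
    (ae_of_all _ (h0 i))]

lemma integrable_exponentialPDFReal {r : ℝ} (hr : 0 < r) :
    Integrable (exponentialPDFReal r) := by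
  refine ⟨(measurable_exponentialPDFReal r).aestronglyMeasurable, ?_⟩
  rw [hasFiniteIntegral_iff_ofReal (ae_of_all _ (exponentialPDFReal_nonneg hr))]
  exact (lintegral_exponentialPDF_eq_one hr).trans_lt ENNReal.one_lt_top

lemma expLaw_eq_withDensity {m : ℕ} {rate : Fin m → ℝ} (hr : ∀ j, 0 < rate j) :
    expLaw rate = volume.withDensity fun x =>
      ENNReal.ofReal (∏ j, exponentialPDFReal (rate j) (x j)) :=
  pi_withDensity_ofReal (fun j => exponentialPDFReal_nonneg (hr j))
    fun j => integrable_exponentialPDFReal (hr j)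

lemma prod_exponentialPDFReal {m : ℕ} (rate x : Fin m → ℝ) :
    ENNReal.ofReal (∏ j, exponentialPDFReal (rate j) (x j)) = (orthant m).indicator
      (fun x => ENNReal.ofReal ((∏ j, rate j) * Real.exp (-∑ j, rate j * x j))) x := by
  have h : ∀ r y : ℝ, exponentialPDFReal r y = if 0 ≤ y then r * Real.exp (-(r * y)) else 0 :=
    fun r y => by simp [exponentialPDFReal, gammaPDFReal]
  by_cases hx : x ∈ orthant m
  · rw [indicator_of_mem hx, ← Finset.sum_neg_distrib, Real.exp_sum, ← Finset.prod_mul_distrib]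
    congr 1
    exact Finset.prod_congr rfl fun j _ => by rw [h, if_pos (hx j)]
  · rw [indicator_of_notMem hx]
    obtain ⟨j, hj⟩ := not_forall.1 hx
    rw [Finset.prod_eq_zero (Finset.mem_univ j) (by rw [h, if_neg hj]), ENNReal.ofReal_zero]

lemma measurableSet_orthant (m : ℕ) : MeasurableSet (orthant m) := by
  rw [show orthant m = ⋂ j, {x | 0 ≤ x j} by ext; simp [orthant]]
  exact MeasurableSet.iInter fun j => measurableSet_le measurable_const (measurable_pi_apply j)

lemma lintegral_ofReal_expMeasure {r : ℝ} (hr : 0 < r) :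
    ∫⁻ x, ENNReal.ofReal x ∂(expMeasure r) = ENNReal.ofReal (1 / r) := by
  have h : expMeasure r = volume.withDensity (exponentialPDF r) := rfl
  have hm : Measurable (exponentialPDF r) := (measurable_exponentialPDFReal r).ennreal_ofReal
  rw [h, lintegral_withDensity_eq_lintegral_mul _ hm (by fun_prop)]
  have h1 : (fun x => (exponentialPDF r * fun x => ENNReal.ofReal x) x) = (Ioi (0 : ℝ)).indicator
      fun x => ENNReal.ofReal (r * (x * Real.exp (-(r * x)))) := by
    ext x
    rcases le_or_gt x 0 with hx | hx
    · simp [hx, ENNReal.ofReal_of_nonpos hx]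
    · rw [indicator_of_mem (mem_Ioi.2 hx), Pi.mul_apply, exponentialPDF_of_nonneg hx.le,
        ← ENNReal.ofReal_mul (by positivity)]
      ring_nf
  have h2 := Real.integral_rpow_mul_exp_neg_mul_Ioi (a := 2) two_pos hr
  have h3 : ∫ x in Ioi (0 : ℝ), x * Real.exp (-(r * x)) = (1 / r) ^ 2 := by
    rw [show (2 : ℝ) - 1 = 1 by norm_num] at h2
    simpa using h2
  -- A non-integrable function would have integral `0` by convention, contradicting the positive
  -- value just computed.
  have hi : IntegrableOn (fun x => x * Real.exp (-(r * x))) (Ioi (0 : ℝ)) := by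
    by_contra hc
    rw [integral_undef hc] at h3
    have : 0 < (1 / r) ^ 2 := by positivity
    exact this.ne h3
  rw [h1, lintegral_indicator measurableSet_Ioi, ← ofReal_integral_eq_lintegral_ofReal
    (hi.const_mul r), integral_const_mul, h3]
  · congr 1
    field_simp
  · filter_upwards [ae_restrict_mem measurableSet_Ioi] with x (hx : 0 < x)
    simp only [Pi.zero_apply]
    positivity

lemma lintegral_sum_expLaw {m : ℕ} {rate : Fin m → ℝ} (hr : ∀ j, 0 < rate j) :
    ∫⁻ x, ∑ j, ENNReal.ofReal (x j) ∂(expLaw rate) = ENNReal.ofReal (∑ j, 1 / rate j) := by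
  have := fun j => isProbabilityMeasure_expMeasure (hr j)
  rw [lintegral_finsetSum _ (fun j _ => by fun_prop),
    ENNReal.ofReal_sum_of_nonneg fun j _ => (one_div_pos.2 (hr j)).le]
  refine Finset.sum_congr rfl fun j _ => ?_
  rw [← lintegral_ofReal_expMeasure (hr j)]
  exact (measurePreserving_eval (fun j => expMeasure (rate j)) j).lintegral_comp
    ENNReal.measurable_ofReal

/-- A bound along almost every ray, in terms of the sum of the coordinates, integrates. -/
lemma lintegral_expLaw_le {m : ℕ} (hm : 1 ≤ m) {rate : Fin m → ℝ} (hr : ∀ j, 0 < rate j)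
    {K : ℝ} (hK : 0 ≤ K) {p : (Fin m → ℝ) → ENNReal}
    (hp : ∀ᵐ z : Fin m → ℝ, 1 ≤ ∑ j, rate j * z j → (∑ j, rate j * z j)⁻¹ • z ∈ orthant m →
      ∫⁻ r in Ioi (0 : ℝ), ENNReal.ofReal (r ^ (m - 1) * Real.exp (-r)) *
        p (r • (∑ j, rate j * z j)⁻¹ • z) ≤
      ENNReal.ofReal ((∑ j, ((∑ j, rate j * z j)⁻¹ • z) j) * K)) :
    ∫⁻ x, p x ∂(expLaw rate) ≤ ENNReal.ofReal (K / m.factorial * ∑ j, 1 / rate j) := by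
  set N : (Fin m → ℝ) → ℝ := fun z => ∑ j, rate j * z j
  have hNm : Measurable N := by fun_prop
  have hhom : ∀ c : ℝ, ∀ x, N (c • x) = c * N x := fun c x => by
    simp only [N, Finset.mul_sum, Pi.smul_apply, smul_eq_mul]
    exact Finset.sum_congr rfl fun j _ => by ring
  have hD := measurableSet_orthant m
  set φ : (Fin m → ℝ) → ENNReal := (orthant m).indicator
    (fun x => ENNReal.ofReal ((∏ j, rate j) * Real.exp (-N x)))
  have hφm : Measurable φ := Measurable.indicator (by fun_prop) hD
  have hF : expLaw rate = volume.withDensity φ := by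
    rw [expLaw_eq_withDensity hr]
    congr 1
    exact funext fun x => prod_exponentialPDFReal rate x
  have hNpos : ∀ᵐ x : Fin m → ℝ, x ∈ orthant m → 0 < N x := by
    have h0 : ∀ᵐ x : Fin m → ℝ, x ≠ 0 := by
      have : Nonempty (Fin m) := ⟨⟨0, hm⟩⟩
      simp [ae_iff]
    filter_upwards [h0] with x hx hxD
    obtain ⟨j, hj⟩ := Function.ne_iff.1 hx
    exact Finset.sum_pos' (fun i _ => mul_nonneg (hr i).le (hxD i))
      ⟨j, Finset.mem_univ j, mul_pos (hr j) (lt_of_le_of_ne (hxD j) (Ne.symm hj))⟩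
  have key : ∀ g : (Fin m → ℝ) → ENNReal, Measurable g → ∫⁻ x, g x ∂(expLaw rate) =
      ∫⁻ z in {z | 1 ≤ N z}, ENNReal.ofReal ((N z ^ (m + 1))⁻¹) *
        ∫⁻ r in Ioi (0 : ℝ), ENNReal.ofReal (r ^ (m - 1)) *
          (φ * g) (r • (N z)⁻¹ • z) := by
    intro g hg
    rw [← lintegral_eq_lintegral_rays hm hNm hhom (hφm.mul hg), hF,
      lintegral_withDensity_eq_lintegral_mul _ hφm hg,
      ← lintegral_indicator (measurableSet_lt measurable_const hNm)]
    refine lintegral_congr_ae ?_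
    filter_upwards [hNpos] with x hx
    by_cases hxD : x ∈ orthant m
    · rw [indicator_of_mem (show x ∈ {x | 0 < N x} from hx hxD)]
    · simp [indicator, φ, hxD]
  have ray : ∀ g : (Fin m → ℝ) → ENNReal, ∀ z, 1 ≤ N z →
      ∫⁻ r in Ioi (0 : ℝ), ENNReal.ofReal (r ^ (m - 1)) * (φ * g) (r • (N z)⁻¹ • z) =
      ENNReal.ofReal (∏ j, rate j) * (orthant m).indicator (fun y => ∫⁻ r in Ioi (0 : ℝ),
        ENNReal.ofReal (r ^ (m - 1) * Real.exp (-r)) * g (r • y)) ((N z)⁻¹ • z) := by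
    intro g z hz
    have hNz : N ((N z)⁻¹ • z) = 1 := by
      rw [hhom, inv_mul_cancel₀ (one_pos.trans_le hz).ne']
    set y := (N z)⁻¹ • z
    have hmem : ∀ r : ℝ, 0 < r → (r • y ∈ orthant m ↔ y ∈ orthant m) := fun r hr => by
      simp [orthant, hr]
    have hrate : 0 ≤ ∏ j, rate j := Finset.prod_nonneg fun j _ => (hr j).le
    by_cases hy : y ∈ orthant m
    · rw [indicator_of_mem hy, ← lintegral_const_mul' _ _ ENNReal.ofReal_ne_top]
      refine setLIntegral_congr_fun measurableSet_Ioi fun r (hr0 : 0 < r) => ?_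
      simp only [Pi.mul_apply, φ]
      rw [indicator_of_mem ((hmem r hr0).2 hy), hhom, hNz, mul_one, ← mul_assoc, ← mul_assoc,
        ← ENNReal.ofReal_mul (by positivity), ← ENNReal.ofReal_mul hrate]
      ring_nf
    · rw [indicator_of_notMem hy, mul_zero]
      refine (setLIntegral_congr_fun measurableSet_Ioi fun r hr0 => ?_).trans lintegral_zero
      simp [φ, (hmem r hr0), hy]
  -- The payment is not assumed measurable; a measurable minorant with the same lower integral
  -- replaces it.
  obtain ⟨g, hgm, hgp, hg⟩ := exists_measurable_le_lintegral_eq (μ := expLaw rate) p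
  -- The total value is the comparison function: on a ray it integrates to `m! ∑ y_j`, matching the
  -- bound on `p` up to the factor `K / m!`.
  set q : (Fin m → ℝ) → ENNReal := fun x => ∑ j, ENNReal.ofReal (x j)
  have hqm : Measurable q := by fun_prop
  have hqray : ∀ y ∈ orthant m, ∫⁻ r in Ioi (0 : ℝ),
      ENNReal.ofReal (r ^ (m - 1) * Real.exp (-r)) * q (r • y) =
      ENNReal.ofReal (m.factorial * ∑ j, y j) := by
    intro y hy
    have hy0 : 0 ≤ ∑ j, y j := Finset.sum_nonneg fun j _ => hy j
    rw [ENNReal.ofReal_mul (by positivity), ← integral_pow_mul_exp_neg,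
      ofReal_integral_eq_lintegral_ofReal (integrableOn_pow_mul_exp_neg m 0)
        ((ae_restrict_mem measurableSet_Ioi).mono fun r (hr0 : 0 < r) => by
          simp only [Pi.zero_apply]; positivity),
      ← lintegral_mul_const _ (by fun_prop)]
    refine setLIntegral_congr_fun measurableSet_Ioi fun r (hr0 : 0 < r) => ?_
    simp only [q, Pi.smul_apply, smul_eq_mul]
    rw [← ENNReal.ofReal_sum_of_nonneg fun j _ => mul_nonneg hr0.le (hy j),
      ← ENNReal.ofReal_mul (by positivity), ← ENNReal.ofReal_mul (by positivity)]
    rw [← Finset.mul_sum]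
    obtain ⟨k, rfl⟩ := Nat.exists_eq_add_of_le' hm
    simp only [add_tsub_cancel_right]
    ring_nf
  have hKm : 0 ≤ K / m.factorial := by positivity
  calc ∫⁻ x, p x ∂(expLaw rate) = ∫⁻ x, g x ∂(expLaw rate) := hg
    _ ≤ ENNReal.ofReal (K / m.factorial) * ∫⁻ x, q x ∂(expLaw rate) := by
        rw [key g hgm, key q hqm, ← lintegral_const_mul' _ _ ENNReal.ofReal_ne_top]
        refine setLIntegral_mono_ae' (measurableSet_le measurable_const hNm) ?_
        filter_upwards [hp] with z hz hNz
        rw [ray g z hNz, ray q z hNz, mul_left_comm (ENNReal.ofReal (K / _)),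
          mul_left_comm (ENNReal.ofReal (K / _))]
        gcongr
        by_cases hy : (N z)⁻¹ • z ∈ orthant m
        · rw [indicator_of_mem hy, indicator_of_mem hy, hqray _ hy, ← ENNReal.ofReal_mul hKm]
          refine (lintegral_mono fun r => mul_le_mul_right (hgp _) _).trans
            ((hz hNz hy).trans_eq ?_)
          rw [← mul_assoc, div_mul_cancel₀ _ (by positivity), mul_comm]
        · rw [indicator_of_notMem hy]
          exact bot_le
    _ = _ := by
        rw [lintegral_sum_expLaw hr, ENNReal.ofReal_mul hKm]

/-! ### Revenue bounds -/

lemma Mechanism.expectedRevenue_expLaw_le {m : ℕ} (hm : 1 ≤ m) {rate : Fin m → ℝ}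
    (hr : ∀ j, 0 < rate j) {M : Mechanism (orthant m)} (hIR : M.IsIR) (hIC : M.IsIC) :
    M.expectedRevenue (expLaw rate) ≤
      ENNReal.ofReal (GFun m / m.factorial * ∑ j, 1 / rate j) := by
  refine lintegral_expLaw_le hm hr (GFun_nonneg m) (ae_of_all _ fun z _ hy => ?_)
  set y := (∑ j, rate j * z j)⁻¹ • z
  have hmem : ∀ t : ℝ, 0 < t → t • y ∈ orthant m := fun t ht j => mul_nonneg ht.le (hy j)
  have hray := lintegral_ray_le hm (C := ∑ j, y j)
    (h := fun t => M.utility (t • y) (t • y)) (s := fun t => ∑ j, M.alloc (t • y) j * y j)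
    (fun t ht => hIR _ (hmem t ht))
    (fun t ht => Finset.sum_nonneg fun j _ =>
      mul_nonneg (M.alloc_mem _ (hmem t ht) j).1 (hy j))
    (fun t ht => Finset.sum_le_sum fun j _ =>
      mul_le_of_le_one_left (hy j) (M.alloc_mem _ (hmem t ht) j).2)
    -- Incentive compatibility for type `t' • y` reporting `t • y` is exactly the subgradient
    -- inequality on the ray, so no differentiability is required.
    (fun t ht t' ht' => by
      refine le_of_eq_of_le ?_ (hIC (t' • y) (hmem t' ht') (t • y) (hmem t ht))
      simp only [Mechanism.utility, Pi.smul_apply, smul_eq_mul, mul_left_comm _ t,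
        mul_left_comm _ t', ← Finset.mul_sum]
      ring)
  refine le_of_eq_of_le ?_ hray
  congr with t
  congr 2
  simp only [Mechanism.utility, Pi.smul_apply, smul_eq_mul, mul_left_comm _ t, ← Finset.mul_sum]
  ring

lemma ConvexOn.add_rightDeriv_mul_le {S : Set ℝ} {h : ℝ → ℝ} (hh : ConvexOn ℝ S h)
    (hS : IsOpen S) {t t' : ℝ} (ht : t ∈ S) (ht' : t' ∈ S) :
    h t + derivWithin h (Ioi t) t * (t' - t) ≤ h t' := by
  have hti : t ∈ interior S := by rwa [hS.interior_eq]
  rcases lt_trichotomy t t' with hlt | rfl | hlt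
  · have h1 := hh.rightDeriv_le_slope_of_mem_interior hti ht' hlt
    rw [slope_def_field, le_div_iff₀ (sub_pos.2 hlt)] at h1
    linarith
  · simp
  · have h1 := (hh.slope_le_leftDeriv_of_mem_interior ht' hti hlt).trans
      (hh.leftDeriv_le_rightDeriv_of_mem_interior hti)
    rw [slope_def_field, div_le_iff₀ (sub_pos.2 hlt)] at h1
    linarith

lemma fderiv_apply_eq_sum_partialDeriv {m : ℕ} (u : (Fin m → ℝ) → ℝ) (x y : Fin m → ℝ) :
    fderiv ℝ u x y = ∑ j, partialDeriv u j x * y j := by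
  conv_lhs => rw [pi_eq_sum_univ' y, map_sum]
  refine Finset.sum_congr rfl fun j _ => ?_
  rw [map_smul, smul_eq_mul, mul_comm, partialDeriv]

/-- The right derivative of `u` along a ray serves as slope. It exists at every point of the open
ray, and for almost every ray it agrees almost everywhere with the directional derivative given by
the gradient. -/
lemma IsFeasibleUtility.lintegral_le {m : ℕ} (hm : 1 ≤ m) {rate : Fin m → ℝ}
    (hr : ∀ j, 0 < rate j) {u : (Fin m → ℝ) → ℝ} (hu : IsFeasibleUtility (orthant m) u) :
    ∫⁻ x, ENNReal.ofReal (∑ j, partialDeriv u j x * x j - u x) ∂(expLaw rate) ≤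
      ENNReal.ofReal (GFun m / m.factorial * ∑ j, 1 / rate j) := by
  refine lintegral_expLaw_le hm hr (GFun_nonneg m) ?_
  have hae := (ae_restrict_iff' (measurableSet_orthant m)).1 hu.partialDeriv_mem
  filter_upwards [ae_ae_ray hm (N := fun z => ∑ j, rate j * z j) (by fun_prop)
    (fun c x => by
      simp only [Finset.mul_sum, Pi.smul_apply, smul_eq_mul]
      exact Finset.sum_congr rfl fun j _ => by ring) hae] with z hz hz1 hy
  specialize hz hz1
  set y := (∑ j, rate j * z j)⁻¹ • z
  have hmem : ∀ t : ℝ, 0 < t → t • y ∈ orthant m := fun t ht j => mul_nonneg ht.le (hy j)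
  set h : ℝ → ℝ := fun t => u (t • y)
  have hconv : ConvexOn ℝ (Ioi 0) h :=
    (hu.convex.comp_linearMap (LinearMap.toSpanSingleton ℝ (Fin m → ℝ) y)).subset
      (fun t ht => hmem t ht) (convex_Ioi 0)
  set s : ℝ → ℝ := fun t => derivWithin h (Ioi t) t
  have hgood : ∀ᵐ t ∂(volume.restrict (Ioi (0 : ℝ))), 0 < t ∧
      s t = ∑ j, partialDeriv u j (t • y) * y j ∧ 0 ≤ s t ∧ s t ≤ ∑ j, y j := by
    filter_upwards [hz, ae_restrict_mem measurableSet_Ioi] with t ht (ht0 : 0 < t)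
    obtain ⟨hd, hp⟩ := ht (hmem t ht0)
    have h1 : HasDerivAt h (fderiv ℝ u (t • y) y) t := by
      have h2 : HasDerivAt (fun t : ℝ => t • y) y t := by
        simpa using (hasDerivAt_id t).smul_const y
      exact hd.hasFDerivAt.comp_hasDerivAt t h2
    have h3 : s t = ∑ j, partialDeriv u j (t • y) * y j := by
      rw [← fderiv_apply_eq_sum_partialDeriv]
      exact h1.hasDerivWithinAt.derivWithin (uniqueDiffWithinAt_Ioi t)
    refine ⟨ht0, h3, ?_, ?_⟩
    · rw [h3]
      exact Finset.sum_nonneg fun j _ => mul_nonneg (hp j).1 (hy j)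
    · rw [h3]
      exact Finset.sum_le_sum fun j _ => mul_le_of_le_one_left (hy j) (hp j).2
  -- Good points are dense on the ray. As the slope is monotone, its almost everywhere bounds then
  -- extend to every `t > 0`.
  have hex : ∀ a b : ℝ, 0 ≤ a → a < b → ∃ t, a < t ∧ t < b ∧ 0 ≤ s t ∧ s t ≤ ∑ j, y j := by
    intro a b ha hab
    have h1 : ∀ᵐ t ∂(volume.restrict (Ioo a b)), 0 ≤ s t ∧ s t ≤ ∑ j, y j :=
      ae_mono (Measure.restrict_mono (fun t ht => lt_of_le_of_lt ha ht.1) le_rfl)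
        (hgood.mono fun t ht => ht.2.2)
    have : (ae (volume.restrict (Ioo a b))).NeBot := by
      rw [ae_neBot, Ne, Measure.restrict_eq_zero]
      simp [hab]
    obtain ⟨t, ht, ht'⟩ := (h1.and (ae_restrict_mem measurableSet_Ioo)).exists
    exact ⟨t, ht'.1, ht'.2, ht⟩
  have hsub : ∀ t ∈ Ioi (0 : ℝ), ∀ t' ∈ Ioi (0 : ℝ), h t + s t * (t' - t) ≤ h t' :=
    fun t ht t' ht' => ConvexOn.add_rightDeriv_mul_le hconv isOpen_Ioi ht ht'
  have hmono := monotoneOn_of_subgradient hsub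
  have hray := lintegral_ray_le hm (C := ∑ j, y j) (h := h) (s := s)
    (fun t ht => hu.nonneg _ (hmem t ht))
    (fun t ht => by
      obtain ⟨t', h1, h2, h3, -⟩ := hex 0 t le_rfl ht
      exact h3.trans (hmono h1 ht h2.le))
    (fun t ht => by
      obtain ⟨t', h1, -, -, h4⟩ := hex t (t + 1) ht.le (by linarith)
      exact (hmono ht (ht.trans h1) h1.le).trans h4) hsub
  refine le_of_eq_of_le (lintegral_congr_ae ?_) hray
  filter_upwards [hgood] with t ht
  congr 2
  rw [ht.2.1]
  simp only [h, Pi.smul_apply, smul_eq_mul, mul_left_comm _ t, ← Finset.mul_sum]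

/-- Dropping the negative part suffices when `f` is integrable; otherwise the integral is `0` by
convention, which is why `b` must be nonnegative. -/
lemma integral_le_of_lintegral_ofReal_le {α : Type*} [MeasurableSpace α] {μ : Measure α}
    {f : α → ℝ} {b : ℝ} (hb : 0 ≤ b) (h : ∫⁻ x, ENNReal.ofReal (f x) ∂μ ≤ ENNReal.ofReal b) :
    ∫ x, f x ∂μ ≤ b := by
  by_cases hf : Integrable f μ
  · rw [integral_eq_lintegral_pos_part_sub_lintegral_neg_part hf]
    have := ENNReal.toReal_le_of_le_ofReal hb h
    linarith [ENNReal.toReal_nonneg (a := ∫⁻ x, ENNReal.ofReal (-f x) ∂μ)]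
  · rwa [integral_undef hf]

lemma revenueBound_nonneg {m : ℕ} {rate : Fin m → ℝ} (hr : ∀ j, 0 < rate j) :
    0 ≤ GFun m / m.factorial * ∑ j, 1 / rate j :=
  mul_nonneg (div_nonneg (GFun_nonneg m) (by positivity))
    (Finset.sum_nonneg fun j _ => (one_div_pos.2 (hr j)).le)

lemma optimalRevenue_expLaw_le {m : ℕ} (hm : 1 ≤ m) {rate : Fin m → ℝ} (hr : ∀ j, 0 < rate j) :
    optimalRevenue (orthant m) (expLaw rate) ≤
      ((GFun m / m.factorial * ∑ j, 1 / rate j : ℝ) : EReal) := by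
  refine iSup₂_le fun M hM => ?_
  have h := EReal.coe_ennreal_le_coe_ennreal_iff.2
    (M.expectedRevenue_expLaw_le hm hr hM.1 hM.2)
  rwa [EReal.coe_ennreal_ofReal, max_eq_left (revenueBound_nonneg hr)] at h

lemma optimalUtilityRevenue_expLaw_le {m : ℕ} (hm : 1 ≤ m) {rate : Fin m → ℝ}
    (hr : ∀ j, 0 < rate j) :
    optimalUtilityRevenue (orthant m) (expLaw rate) ≤
      ((GFun m / m.factorial * ∑ j, 1 / rate j : ℝ) : EReal) := by
  refine iSup₂_le fun u hu => EReal.coe_le_coe_iff.2 ?_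
  exact integral_le_of_lintegral_ofReal_le (revenueBound_nonneg hr)
    ((setLIntegral_le_lintegral _ _).trans (hu.lintegral_le hm hr))

lemma revenueBound_const {m : ℕ} (hm : 1 ≤ m) {r : ℝ} (hr : 0 < r) :
    GFun m / m.factorial * ∑ _j : Fin m, 1 / r = GFun m / ((m - 1).factorial * r) := by
  obtain ⟨k, rfl⟩ := Nat.exists_eq_add_of_le' hm
  simp only [Finset.sum_const, Finset.card_univ, Fintype.card_fin, nsmul_eq_mul,
    add_tsub_cancel_right, Nat.factorial_succ]
  push_cast
  field_simp

end OptimalSelling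

theorem mainTheorem2 (m : ℕ) (hm : 1 ≤ m) :
    -- `gammaStar m` is the unique root of `g(m, ·)` on `[0, ∞)`
    (∀ w : ℝ, (0 ≤ w ∧ OptimalSelling.gFun m w = 0) ↔ w = OptimalSelling.gammaStar m) ∧
    -- the expressions for `G(m)`
    OptimalSelling.GFun m =
      ∫ w in Set.Ioi (OptimalSelling.gammaStar m), OptimalSelling.gFun m w ∧
    OptimalSelling.GFun m =
      OptimalSelling.gammaStar m * OptimalSelling.incGamma m (OptimalSelling.gammaStar m) ∧
    OptimalSelling.GFun m =
      OptimalSelling.gammaStar m ^ (m + 1) * Real.exp (-OptimalSelling.gammaStar m) ∧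
    -- independent exponential valuations
    (∀ rate : Fin m → ℝ, (∀ j, 0 < rate j) →
      OptimalSelling.optimalRevenue (OptimalSelling.orthant m) (OptimalSelling.expLaw rate) ≤
        ((OptimalSelling.GFun m / (m.factorial : ℝ) * ∑ j, 1 / rate j : ℝ) : EReal) ∧
      OptimalSelling.optimalUtilityRevenue (OptimalSelling.orthant m)
          (OptimalSelling.expLaw rate) ≤
        ((OptimalSelling.GFun m / (m.factorial : ℝ) * ∑ j, 1 / rate j : ℝ) : EReal)) ∧
    -- i.i.d. exponential valuations
    (∀ r : ℝ, 0 < r →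
      OptimalSelling.optimalRevenue (OptimalSelling.orthant m)
          (OptimalSelling.expLaw fun _ : Fin m => r) ≤
        ((OptimalSelling.GFun m / (((m - 1).factorial : ℝ) * r) : ℝ) : EReal) ∧
      OptimalSelling.optimalUtilityRevenue (OptimalSelling.orthant m)
          (OptimalSelling.expLaw fun _ : Fin m => r) ≤
        ((OptimalSelling.GFun m / (((m - 1).factorial : ℝ) * r) : ℝ) : EReal)) := by
  open OptimalSelling in
  exact ⟨eq_gammaStar_iff hm, GFun_eq_integral_gFun hm, GFun_eq_mul_incGamma hm,
    GFun_eq_pow_mul_exp hm,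
    fun rate hr => ⟨optimalRevenue_expLaw_le hm hr, optimalUtilityRevenue_expLaw_le hm hr⟩,
    fun r hr => by
      rw [← revenueBound_const hm hr]
      exact ⟨optimalRevenue_expLaw_le hm fun _ => hr,
        optimalUtilityRevenue_expLaw_le hm fun _ => hr⟩⟩
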